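/- **Proposition (Local reciprocity as cup product).** Let $L/K$ be a finite Galois extension of nonarchimedean local fields with Galois group $G=\mathrm{Gal}(L/K)$, and write $H_T^r(G,-)$, $r\in\mathbb Z$, for Tate cohomology. Let $\varphi\colon G\times G\to L^\times$ be a $2$-cocycle whose class $[\varphi]$ generates $H^2(G,L^\times)=H_T^2(G,L^\times)$ (for instance a cocycle representing the fundamental class). Let $$L^\times(\varphi)=L^\times\oplus\bigoplus_{\sigma\in G,\ \sigma\ne 1}\mathbb Z\,x_\sigma,\qquad \sigma\cdot x_\tau=x_{\sigma\tau}-x_\sigma+\varphi(\sigma,\tau),\qquad x_1:=\varphi(1,1),$$ be the splitting module of $\varphi$ ($L^\times$ being written additively, with its given $G$-action), and let $\alpha\colon L^\times(\varphi)\to I_G$ be the $G$-map to the augmentation ideal with $\alpha|_{L^\times}=0$ and $\alpha(x_\sigma)=\sigma-1$. The inverse of the local reciprocity map attached to $[\varphi]$ is the composite of connecting homomorphisms $$H_T^{-2}(G,\mathbb Z)\longrightarrow H_T^{-1}(G,I_G)\longrightarrow H_T^{0}(G,L^\times)=K^\times/N_{L/K}(L^\times)$$ of the exact sequences $0\to I_G\to\mathbb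 Z[G]\to\mathbb Z\to 0$ and $0\to L^\times\to L^\times(\varphi)\xrightarrow{\alpha} I_G\to 0$ (recall $H_T^{-2}(G,\mathbb Z)\cong G^{\mathrm{ab}}$). This map equals the cup product with $[\varphi]$: for every $x\in H_T^{-2}(G,\mathbb Z)$, its image under the composite is $$[\varphi]\smile x\in H_T^0(G,L^\times\otimes\mathbb Z)=H_T^0(G,L^\times).$$ Here $\smile\colon H_T^r(G,A)\times H_T^s(G,B)\to H_T^{r+s}(G,A\otimes B)$ is the cup product on Tate cohomology: for $r=0$ the class of $a\in A^G$ acts by the map induced by $b\mapsto a\otimes b$, and $(\delta u)\smile v=\delta(u\smile v)$ for the connecting homomorphisms of the sequences $0\to A\to\mathbb Z[G]\otimes A\to J_G\otimes A\to 0$ and $0\to I_G\otimes A\to\mathbb Z[G]\otimes A\to A\to 0$ and of these sequences tensored with $B$, where $J_G=\mathbb Z[G]/\mathbb Z\sum_{g\in G}g$. -/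

import Mathlib

noncomputable section

namespace TateCup
open CategoryTheory MonoidalCategory groupHomology groupCohomology
open Limits TensorProduct

set_option linter.unusedSectionVars false

universe u
variable {R G : Type u} [CommRing R] [Group G] [Fintype G]

/-- The norm `∑ g, g ∘ f ∘ g⁻¹` of a linear map `f`, a morphism of representations. -/
def normHom {A B : Rep.{u} R G} (f : A.V →ₗ[R] B.V) : A ⟶ B :=
  Rep.ofHom ⟨∑ g : G, B.ρ g ∘ₗ f ∘ₗ A.ρ g⁻¹, fun h => by
    ext a
    simp only [LinearMap.coe_comp, Function.comp_apply, LinearMap.sum_apply, map_sum]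
    refine Fintype.sum_equiv (Equiv.mulLeft h⁻¹) _ _ fun g => ?_
    simp [map_mul]⟩

lemma normHom_apply {A B : Rep.{u} R G} (f : A.V →ₗ[R] B.V) (a : A.V) :
    (normHom f).hom a = ∑ g : G, B.ρ g (f (A.ρ g⁻¹ a)) := by
  change (∑ g : G, B.ρ g ∘ₗ f ∘ₗ A.ρ g⁻¹) a = _
  simp

lemma contractNth_zero_cons {n : ℕ} (x : G) (g : Fin (n + 1) → G) :
    Fin.contractNth 0 (· * ·) (Fin.cons x g : Fin (n + 2) → G) =
      Fin.cons (x * g 0) (fun i => g i.succ) := by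
  ext k
  refine Fin.cases ?_ (fun k => ?_) k
  · rw [Fin.contractNth_apply_of_eq _ _ _ _ (by simp)]; simp
  · rw [Fin.contractNth_apply_of_gt _ _ _ _ (by simp)]; simp

lemma contractNth_succ_cons {n : ℕ} (j : Fin (n + 1)) (x : G) (g : Fin (n + 1) → G) :
    Fin.contractNth j.succ (· * ·) (Fin.cons x g : Fin (n + 2) → G) =
      Fin.cons x (Fin.contractNth j (· * ·) g) := by
  ext k
  refine Fin.cases ?_ (fun k => ?_) k
  · rw [Fin.contractNth_apply_of_lt _ _ _ _ (by simp)]; simp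
  · simp [Fin.contractNth, Fin.castSucc_succ]

/-- A contraction of cochains exhibiting `normHom f` as null-homotopic. -/
def hCo {A B : Rep.{u} R G} (f : A.V →ₗ[R] B.V) (n : ℕ) :
    ((Fin (n + 1) → G) → A.V) →ₗ[R] ((Fin n → G) → B.V) :=
  LinearMap.pi fun g => ∑ x : G, B.ρ x⁻¹ ∘ₗ f ∘ₗ LinearMap.proj (Fin.cons x g)

lemma hCo_apply {A B : Rep.{u} R G} (f : A.V →ₗ[R] B.V) (n : ℕ) (φ g) :
    hCo f n φ g = ∑ x : G, B.ρ x⁻¹ (f (φ (Fin.cons x g))) := by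
  simp [hCo]

lemma hCo_spec {A B : Rep.{u} R G} (f : A.V →ₗ[R] B.V) (n : ℕ) (φ : (Fin (n + 1) → G) → A.V) (g) :
    hCo f (n + 1) ((inhomogeneousCochains.d A (n + 1)).hom φ) g +
      (inhomogeneousCochains.d B n).hom (hCo f n φ) g = (normHom f).hom (φ g) := by
  rw [inhomogeneousCochains.d_hom_apply, hCo_apply, normHom_apply]
  simp only [inhomogeneousCochains.d_hom_apply, hCo_apply]
  simp only [Fin.cons_zero, Fin.cons_succ, Fin.sum_univ_succ (n := n + 1), contractNth_zero_cons,
    contractNth_succ_cons, map_add, map_sum, Finset.sum_add_distrib, Fin.val_zero, Fin.val_succ,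
    Finset.smul_sum, LinearMap.map_smul]
  rw [Finset.sum_comm (s := Finset.univ (α := G))]
  have h1 : ∑ x : G, B.ρ x⁻¹ (f ((-1 : R) ^ (0 + 1) • φ (Fin.cons (x * g 0) fun i => g i.succ))) =
      - ∑ x : G, B.ρ (g 0) (B.ρ x⁻¹ (f (φ (Fin.cons x fun i => g i.succ)))) := by
    rw [← Finset.sum_neg_distrib]
    refine Fintype.sum_equiv (Equiv.mulRight (g 0)) _ _ fun x => ?_
    simp [map_mul]
  have h2 : ∑ x : G, B.ρ x⁻¹ (f (A.ρ x (φ g))) = ∑ x : G, B.ρ x (f (A.ρ x⁻¹ (φ g))) :=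
    Fintype.sum_equiv (Equiv.inv G) _ _ fun x => by simp
  simp only [pow_succ (-1 : R)] at h1 ⊢
  simp at h1 ⊢
  rw [h2, h1]
  abel

/-- A contraction of chains exhibiting `normHom f` as null-homotopic. -/
def hCh {A B : Rep.{u} R G} (f : A.V →ₗ[R] B.V) (n : ℕ) :
    ((Fin n → G) →₀ A.V) →ₗ[R] ((Fin (n + 1) → G) →₀ B.V) :=
  Finsupp.lsum R fun g => ∑ x : G, Finsupp.lsingle (Fin.cons x g) ∘ₗ f ∘ₗ A.ρ x

lemma hCh_single {A B : Rep.{u} R G} (f : A.V →ₗ[R] B.V) (n : ℕ) (g a) :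
    hCh f n (.single g a) = ∑ x : G, Finsupp.single (Fin.cons x g) (f (A.ρ x a)) := by
  simp [hCh]

lemma dCh_single (A : Rep.{u} R G) (n : ℕ) (g : Fin (n + 1) → G) (a : A.V) :
    (inhomogeneousChains.d A n).hom (.single g a) =
      Finsupp.single (fun i => g i.succ) (A.ρ (g 0)⁻¹ a) +
      ∑ j : Fin (n + 1), (-1 : R) ^ ((j : ℕ) + 1) • Finsupp.single (Fin.contractNth j (· * ·) g) a :=
  inhomogeneousChains.d_single n g a

lemma dCh_sum_single (A : Rep.{u} R G) (n : ℕ) (g : G → Fin (n + 1) → G) (a : G → A.V) :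
    (inhomogeneousChains.d A n).hom (∑ x : G, Finsupp.single (g x) (a x)) =
      ∑ x : G, (Finsupp.single (fun i => g x i.succ) (A.ρ (g x 0)⁻¹ (a x)) +
      ∑ j : Fin (n + 1), (-1 : R) ^ ((j : ℕ) + 1) •
        Finsupp.single (Fin.contractNth j (· * ·) (g x)) (a x)) :=
  (map_sum (inhomogeneousChains.d A n).hom _ _).trans
    (Finset.sum_congr rfl fun _ _ => dCh_single ..)

lemma hCh_spec {A B : Rep.{u} R G} (f : A.V →ₗ[R] B.V) (n : ℕ) (g : Fin (n + 1) → G) (a : A.V) :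
    hCh f n ((inhomogeneousChains.d A n).hom (.single g a)) +
      (inhomogeneousChains.d B (n + 1)).hom (hCh f (n + 1) (.single g a)) =
      .single g ((normHom f).hom a) := by
  rw [dCh_single, hCh_single, normHom_apply, dCh_sum_single]
  simp only [map_add, map_sum, hCh_single, map_smul]
  simp only [Fin.cons_zero, Fin.cons_succ, Fin.sum_univ_succ (n := n + 1), contractNth_zero_cons,
    contractNth_succ_cons, Finset.sum_add_distrib, Fin.val_zero, Fin.val_succ,
    Finset.smul_sum]
  rw [Finset.sum_comm (s := Finset.univ (α := G))]
  have h1 : ∑ x : G, (-1 : R) ^ (0 + 1) • Finsupp.single (Fin.cons (x * g 0) (fun i => g i.succ) : Fin (n + 1) → G)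
        (f (A.ρ x a)) =
      - ∑ x : G, Finsupp.single (Fin.cons x (fun i => g i.succ) : Fin (n + 1) → G) (f (A.ρ x (A.ρ (g 0)⁻¹ a))) := by
    rw [← Finset.sum_neg_distrib]
    refine Fintype.sum_equiv (Equiv.mulRight (g 0)) _ _ fun x => ?_
    simp [map_mul]
  have h2 : ∑ x : G, Finsupp.single g (B.ρ x⁻¹ (f (A.ρ x a))) =
      Finsupp.single g (∑ x : G, B.ρ x (f (A.ρ x⁻¹ a))) := by
    rw [← Finsupp.lsingle_apply (R := R), map_sum]
    exact Fintype.sum_equiv (Equiv.inv G) _ _ fun x => by simp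
  have h2' : (∑ x : G, Finsupp.single (fun i => g i) (B.ρ x⁻¹ (f (A.ρ x a)))) = _ := h2
  simp only [pow_succ (-1 : R)] at h1 ⊢
  simp at h1 h2' ⊢
  rw [h2', h1]
  abel

lemma hCo_spec_zero {A B : Rep.{u} R G} (f : A.V →ₗ[R] B.V) (φ : (Fin 0 → G) → A.V) (g) :
    (∑ x : G, B.ρ x (f (φ default))) + hCo f 0 ((inhomogeneousCochains.d A 0).hom φ) g =
      (normHom f).hom (φ g) := by
  rw [hCo_apply, normHom_apply, Subsingleton.elim g default]
  have h2 : ∑ x : G, B.ρ x⁻¹ (f (A.ρ x (φ default))) = ∑ x : G, B.ρ x (f (A.ρ x⁻¹ (φ default))) :=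
    Fintype.sum_equiv (Equiv.inv G) _ _ fun x => by simp
  have h3 : ∑ x : G, B.ρ x⁻¹ (f (φ default)) = ∑ x : G, B.ρ x (f (φ default)) :=
    Fintype.sum_equiv (Equiv.inv G) _ _ fun x => by simp
  rw [← h2, ← h3, ← Finset.sum_add_distrib]
  refine Finset.sum_congr rfl fun x _ => ?_
  rw [inhomogeneousCochains.d_hom_apply]
  simp only [Fin.cons_zero, Subsingleton.elim _ default]
  simp [← map_add]

lemma hCh_spec_zero {A B : Rep.{u} R G} (f : A.V →ₗ[R] B.V) (g : Fin 0 → G) (a : A.V) :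
    (inhomogeneousChains.d B 0).hom (hCh f 0 (.single g a)) +
      Finsupp.single default (∑ x : G, f (A.ρ x a)) = .single g ((normHom f).hom a) := by
  rw [hCh_single, normHom_apply, dCh_sum_single, Subsingleton.elim g default]
  have h2 : ∑ x : G, B.ρ x⁻¹ (f (A.ρ x a)) = ∑ x : G, B.ρ x (f (A.ρ x⁻¹ a)) :=
    Fintype.sum_equiv (Equiv.inv G) _ _ fun x => by simp
  simp only [Fin.cons_zero,
    Subsingleton.elim _ (default : Fin 0 → G), ← h2, Finset.sum_add_distrib,
    Finsupp.single_finsetSum]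
  simp

lemma homologyMap_eq_zero {K L : CochainComplex (ModuleCat.{u} R) ℤ} (f : K ⟶ L) (i n j : ℤ)
    (hi : i + 1 = n) (_hj : n + 1 = j) (h₁ : K.X n ⟶ L.X i) (h₂ : K.X j ⟶ L.X n)
    (h : f.f n = h₁ ≫ L.d i n + K.d n j ≫ h₂) : HomologicalComplex.homologyMap f n = 0 := by
  rw [← cancel_epi (K.homologyπ n), HomologicalComplex.homologyπ_naturality]
  have : HomologicalComplex.cyclesMap f n = K.iCycles n ≫ h₁ ≫ L.toCycles i n := by
    rw [← cancel_mono (L.iCycles n)]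
    simp [h]
  have hi' : (ComplexShape.up ℤ).prev n = i := by simp [← hi]
  rw [this, Category.assoc, Category.assoc, HomologicalComplex.toCycles_comp_homologyπ]
  simp

lemma tateMap_f_nonneg {A B : Rep.{u} R G} (φ : A ⟶ B) (n : ℕ) (x : (Fin n → G) → A.V) :
    ((tateComplex.map φ).f (n : ℤ)).hom x = fun g => φ.hom (x g) := by
  rfl

lemma tateMap_f_neg {A B : Rep.{u} R G} (φ : A ⟶ B) (n : ℕ) (g : Fin n → G) (a : A.V) :
    ((tateComplex.map φ).f (Int.negSucc n)).hom (Finsupp.single g a) =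
      Finsupp.single g (φ.hom a) := by
  change ((chainsMap (MonoidHom.id G) φ).f n).hom (Finsupp.single g a) = _
  rw [chainsMap_id_f_hom_eq_mapRange]
  simp

/-- A norm induces zero on Tate cohomology. -/
lemma tateMap_normHom {A B : Rep.{u} R G} (f : A.V →ₗ[R] B.V) (n : ℤ) :
    (tateCohomologyFunctor n).map (normHom f) = 0 := by
  change HomologicalComplex.homologyMap (tateComplex.map (normHom f)) n = 0
  let h0 : ((Fin 0 → G) → A.V) →ₗ[R] ((Fin 0 → G) →₀ B.V) :=
    Finsupp.lsingle default ∘ₗ f ∘ₗ LinearMap.proj default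
  rcases n with ((_ | m) | (_ | m))
  · refine homologyMap_eq_zero _ (.negSucc 0) (.ofNat 0) (.ofNat 1) rfl rfl
      (ModuleCat.ofHom h0) (ModuleCat.ofHom (hCo f 0)) ?_
    ext x
    funext g
    refine (hCo_spec_zero f x g).symm.trans ?_
    change _ = (ConcreteCategory.hom (Rep.tateNorm B)) (Finsupp.single default (f (x default))) g +
      hCo f 0 (((inhomogeneousCochains A).d 0 1).hom x) g
    rw [inhomogeneousCochains.d_def, Rep.tateNorm_eq]
    simp [Representation.norm]
  · refine homologyMap_eq_zero _ (m : ℤ) ((m + 1 : ℕ) : ℤ) ((m + 2 : ℕ) : ℤ) rfl rfl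
      (ModuleCat.ofHom (hCo f m)) (ModuleCat.ofHom (hCo f (m + 1))) ?_
    ext x
    funext g
    refine (hCo_spec f m x g).symm.trans ?_
    change _ = ((inhomogeneousCochains B).d m (m + 1)).hom (hCo f m x) g +
      hCo f (m + 1) (((inhomogeneousCochains A).d (m + 1) (m + 2)).hom x) g
    rw [inhomogeneousCochains.d_def, inhomogeneousCochains.d_def, add_comm]
  · refine homologyMap_eq_zero _ (.negSucc 1) (.negSucc 0) (.ofNat 0) rfl rfl
      (ModuleCat.ofHom (hCh f 0)) (ModuleCat.ofHom h0) ?_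
    ext : 1
    refine Finsupp.lhom_ext fun g a => ?_
    refine (tateMap_f_neg _ _ _ _).trans ?_
    change _ = ((inhomogeneousChains B).d 1 0).hom (hCh f 0 (.single g a)) +
      h0 ((ConcreteCategory.hom (Rep.tateNorm A)) (Finsupp.single g a))
    rw [inhomogeneousChains.d_def, Rep.tateNorm_eq]
    refine (hCh_spec_zero f g a).symm.trans ?_
    simp only [h0, Finsupp.single_finsetSum]
    simp [Representation.norm]
  · refine homologyMap_eq_zero _ (Int.negSucc (m + 2)) (Int.negSucc (m + 1)) (Int.negSucc m) rfl rfl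
      (ModuleCat.ofHom (hCh f (m + 1))) (ModuleCat.ofHom (hCh f m)) ?_
    ext : 1
    refine Finsupp.lhom_ext fun g a => ?_
    refine (tateMap_f_neg _ _ _ _).trans ?_
    change _ = ((inhomogeneousChains B).d (m + 2) (m + 1)).hom (hCh f (m + 1) (.single g a)) +
      hCh f m (((inhomogeneousChains A).d (m + 1) m).hom (.single g a))
    rw [inhomogeneousChains.d_def, inhomogeneousChains.d_def]
    exact (hCh_spec f m g a).symm.trans (add_comm _ _)

lemma shortExact_of {S : ShortComplex (Rep.{u} R G)} (hi : Function.Injective S.f.hom)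
    (hs : Function.Surjective S.g.hom) (he : ∀ y, S.g.hom y = 0 → ∃ x, S.f.hom x = y) :
    S.ShortExact := by
  have h1 : Mono S.f := (Rep.mono_iff_injective _).2 hi
  have h2 : Epi S.g := (Rep.epi_iff_surjective _).2 hs
  refine ⟨(S.exact_map_iff_of_faithful (forget₂ (Rep.{u} R G) (ModuleCat.{u} R))).1 ?_⟩
  exact (ShortComplex.moduleCat_exact_iff _).2 he

variable (R G) in
/-- The augmentation `R[G] → R`. -/
def aug : Rep.leftRegular R G ⟶ 𝟙_ (Rep.{u} R G) :=
  Rep.leftRegularHom (Rep.trivial R G R) (1 : R)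

lemma aug_single (g : G) (r : R) : (aug R G).hom (MonoidAlgebra.single g r) = r := by
  refine (Rep.leftRegularHom_hom_single _ _ _).trans ?_
  simp

variable (R G) in
/-- The augmentation ideal `I_G`, the kernel of the augmentation. -/
def augIdeal : Rep.{u} R G :=
  Rep.subrepresentation (Rep.leftRegular R G) (LinearMap.ker (aug R G).hom.toLinearMap) fun g x hx => by
    have := Rep.hom_comm_apply (aug R G) g x
    rw [LinearMap.mem_ker] at hx
    rw [Submodule.mem_comap, LinearMap.mem_ker]
    exact this.trans ((congrArg _ hx).trans (map_zero _))

variable (R G) in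
/-- The map `R → R[G]`, `r ↦ r ∑ g`. -/
def normElt : 𝟙_ (Rep.{u} R G) ⟶ Rep.leftRegular R G :=
  Rep.ofHom (ρ := Representation.trivial R G R) ⟨LinearMap.toSpanSingleton R _
    (∑ g : G, MonoidAlgebra.single g (1 : R)), fun h => by
      refine LinearMap.ext_ring ?_
      simp only [LinearMap.coe_comp, Function.comp_apply, LinearMap.toSpanSingleton_apply,
        map_smul, map_sum, Representation.ofMulAction_single, Representation.trivial_apply]
      congr 1
      exact (Fintype.sum_equiv (Equiv.mulLeft h) _ _ fun x => rfl).symm⟩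

variable (R G) in
/-- `J_G`, the cokernel of `R → R[G]`, `r ↦ r ∑ g`. -/
def coaugQuot : Rep.{u} R G :=
  Rep.quotient (Rep.leftRegular R G) (LinearMap.range (normElt R G).hom.toLinearMap) fun g x hx => by
    obtain ⟨r, rfl⟩ := hx
    exact ⟨r, Rep.hom_comm_apply (normElt R G) g r⟩

variable (R G) in
/-- `0 → I_G → R[G] → R → 0`. -/
def augSeq : ShortComplex (Rep.{u} R G) where
  X₁ := augIdeal R G
  X₂ := Rep.leftRegular R G
  X₃ := 𝟙_ _
  f := Rep.subtype _ _ _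
  g := aug R G
  zero := by
    ext x
    exact x.2

variable (R G) in
/-- `0 → R → R[G] → J_G → 0`. -/
def coaugSeq : ShortComplex (Rep.{u} R G) where
  X₁ := 𝟙_ _
  X₂ := Rep.leftRegular R G
  X₃ := coaugQuot R G
  f := normElt R G
  g := Rep.mkQ _ _ _
  zero := by
    ext : 2
    refine LinearMap.ext fun x => ?_
    exact (Submodule.Quotient.mk_eq_zero _).2 ⟨_, rfl⟩

/-- A short complex of representations that is split exact over `R` stays exact after tensoring. -/
lemma shortExact_tensor {S : ShortComplex (Rep.{u} R G)} (r : S.X₂.V →ₗ[R] S.X₁.V)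
    (hr : ∀ x, r (S.f.hom x) = x) (hs : Function.Surjective S.g.hom)
    (he : ∀ y, S.g.hom y = 0 → ∃ x, S.f.hom x = y) (M : Rep.{u} R G) :
    (S.map (tensorRight M)).ShortExact := by
  refine shortExact_of ?_ ?_ ?_
  · have : LinearMap.rTensor M.V r ∘ₗ LinearMap.rTensor M.V S.f.hom.toLinearMap = LinearMap.id := by
      rw [← LinearMap.rTensor_comp, show r ∘ₗ S.f.hom.toLinearMap = LinearMap.id from LinearMap.ext hr,
        LinearMap.rTensor_id]
    exact Function.LeftInverse.injective (g := LinearMap.rTensor M.V r) fun x => LinearMap.congr_fun this x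
  · exact LinearMap.rTensor_surjective M.V (g := S.g.hom.toLinearMap) hs
  · have hex : Function.Exact S.f.hom.toLinearMap S.g.hom.toLinearMap := fun y =>
      ⟨fun h => he y h, by
        rintro ⟨x, rfl⟩
        have := congrArg (fun f => f.hom x) S.zero
        exact this⟩
    intro y hy
    exact (rTensor_exact M.V hex hs y).1 hy

lemma augSeq_tensor (M : Rep.{u} R G) : ((augSeq R G).map (tensorRight M)).ShortExact := by
  have h1 : (aug R G).hom (MonoidAlgebra.single 1 1) = (1 : R) := aug_single 1 1
  refine shortExact_tensor (S := augSeq R G)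
    (LinearMap.codRestrict (LinearMap.ker (aug R G).hom.toLinearMap)
      (LinearMap.id - (LinearMap.toSpanSingleton R _ (MonoidAlgebra.single (1 : G) (1 : R))) ∘ₗ
        (aug R G).hom.toLinearMap) fun x => ?_) (fun x => ?_) (fun r => ?_) (fun y hy => ?_) M
  · rw [LinearMap.mem_ker]
    change (aug R G).hom ((show (Rep.leftRegular R G).V from x) - (show R from (aug R G).hom x) •
      (show (Rep.leftRegular R G).V from MonoidAlgebra.single (1 : G) (1 : R))) = 0
    rw [map_sub, map_smul]
    refine sub_eq_zero.2 ?_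
    exact (((congrArg (fun t : R => (show R from (aug R G).hom x) • t) h1).trans (mul_one _)).symm)
  · refine Subtype.ext ?_
    change x.1 - (aug R G).hom x.1 • MonoidAlgebra.single (1 : G) (1 : R) = x.1
    rw [show (aug R G).hom x.1 = 0 from x.2, zero_smul, sub_zero]
  · exact ⟨MonoidAlgebra.single 1 r, aug_single _ _⟩
  · exact ⟨⟨y, hy⟩, rfl⟩

lemma coeff_normElt (r : R) :
    MonoidAlgebra.coeffLinearEquiv R (r • ∑ g : G, MonoidAlgebra.single g (1 : R)) 1 = r := by
  classical
  simp [Finsupp.single_apply]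

lemma coaugSeq_tensor (M : Rep.{u} R G) : ((coaugSeq R G).map (tensorRight M)).ShortExact := by
  refine shortExact_tensor (S := coaugSeq R G)
    (Finsupp.lapply (1 : G) ∘ₗ (MonoidAlgebra.coeffLinearEquiv R).toLinearMap)
    (fun x => ?_) (Submodule.mkQ_surjective _) (fun y hy => ?_) M
  · exact coeff_normElt (R := R) (G := G) (show R from x)
  · exact (Submodule.Quotient.mk_eq_zero _).1 hy

/-- `R[G] ⊗ M` has vanishing Tate cohomology. -/
lemma isZero_tate (M : Rep.{u} R G) (n : ℤ) :
    IsZero (tateCohomology (Rep.leftRegular R G ⊗ M) n) := by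
  classical
  let p : (Rep.leftRegular R G).V →ₗ[R] (Rep.leftRegular R G).V :=
    (MonoidAlgebra.coeffLinearEquiv R).symm.toLinearMap ∘ₗ Finsupp.lsingle (1 : G) ∘ₗ
      Finsupp.lapply (1 : G) ∘ₗ (MonoidAlgebra.coeffLinearEquiv R).toLinearMap
  have h : normHom (A := Rep.leftRegular R G ⊗ M) (B := Rep.leftRegular R G ⊗ M)
      (LinearMap.rTensor M.V p) = 𝟙 _ := by
    ext : 2
    refine TensorProduct.ext' fun x m => ?_
    refine (normHom_apply _ _).trans ?_
    change ∑ g : G, TensorProduct.map (Representation.ofMulAction R G G g) (M.ρ g)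
      (LinearMap.rTensor M.V p (TensorProduct.map (Representation.ofMulAction R G G g⁻¹)
        (M.ρ g⁻¹) (x ⊗ₜ m))) = x ⊗ₜ m
    simp only [TensorProduct.map_tmul, LinearMap.rTensor_tmul, Representation.self_inv_apply,
      ← TensorProduct.sum_tmul]
    congr 1
    induction x using MonoidAlgebra.induction_linear with
    | zero => simp
    | add x y hx hy => simp only [map_add, Finset.sum_add_distrib, hx, hy]
    | single h r =>
      have hp : ∀ (a : G), p (MonoidAlgebra.single a r) =
          if a = 1 then MonoidAlgebra.single (1 : G) r else 0 := fun a => by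
        simp only [p, LinearMap.comp_apply, LinearEquiv.coe_coe,
          Finsupp.lapply_apply, Finsupp.lsingle_apply]
        split_ifs with h
        · subst h; simp
        · simp [h]
      simp only [Representation.ofMulAction_single, hp, smul_eq_mul, apply_ite, map_zero, mul_one,
        inv_mul_eq_one]
      simp
  rw [IsZero.iff_id_eq_zero, ← CategoryTheory.Functor.map_id, ← h, tateMap_normHom]

/-- Dimension shift: the connecting map `H^i(G, J_G ⊗ M) → H^j(G, M)`, where `j = i + 1`, of
`0 → M → R[G] ⊗ M → J_G ⊗ M → 0`. -/
def shiftUp (M : Rep.{u} R G) (i j : ℤ) (hij : i + 1 = j) :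
    tateCohomology (coaugQuot R G ⊗ M) i ≅ tateCohomology M j :=
  (TateCohomology.map_tateComplexFunctor_shortExact (coaugSeq_tensor M)).δIso i j hij
    (isZero_tate M i) (isZero_tate M j) ≪≫ (tateCohomologyFunctor j).mapIso (λ_ M)

/-- Dimension shift: the connecting map `H^i(G, M) → H^j(G, I_G ⊗ M)`, where `j = i + 1`, of
`0 → I_G ⊗ M → R[G] ⊗ M → M → 0`. -/
def shiftDown (M : Rep.{u} R G) (i j : ℤ) (hij : i + 1 = j) :
    tateCohomology M i ≅ tateCohomology (augIdeal R G ⊗ M) j :=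
  (tateCohomologyFunctor i).mapIso (λ_ M).symm ≪≫
    (TateCohomology.map_tateComplexFunctor_shortExact (augSeq_tensor M)).δIso i j hij
      (isZero_tate M i) (isZero_tate M j)


instance (n : ℤ) : (tateCohomologyFunctor (R := R) (G := G) n).Additive where
  map_add {A B f g} := by
    change HomologicalComplex.homologyMap (tateComplex.map (f + g)) n = _
    rw [tateComplex.map_add, HomologicalComplex.homologyMap_add]
    rfl

/-- For an invariant element `a` of `A`, the morphism `B → A ⊗ B`, `b ↦ a ⊗ b`. -/
def tmulLeft {A : Rep.{u} R G} (B : Rep.{u} R G) (a : A.ρ.invariants) : B ⟶ A ⊗ B :=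
  Rep.ofHom (σ := A.ρ.tprod B.ρ) ⟨TensorProduct.mk R A.V B.V a.1, fun g => by
    ext b
    simp [(A.ρ.mem_invariants _).1 a.2 g]⟩

lemma tmulLeft_add {A : Rep.{u} R G} (B : Rep.{u} R G) (a a' : A.ρ.invariants) :
    tmulLeft B (a + a') = tmulLeft B a + tmulLeft B a' := by
  ext : 2
  refine LinearMap.ext fun b => ?_
  exact TensorProduct.add_tmul _ _ _

lemma tmulLeft_norm {A : Rep.{u} R G} (B : Rep.{u} R G) (a : A.ρ.invariants) (a' : A.V)
    (h : a.1 = ∑ g : G, A.ρ g a') :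
    tmulLeft B a = normHom (B := A ⊗ B) (TensorProduct.mk R A.V B.V a') := by
  ext : 2
  refine LinearMap.ext fun b => ?_
  refine Eq.trans ?_ (normHom_apply (B := A ⊗ B) _ _).symm
  change a.1 ⊗ₜ b = ∑ g : G, TensorProduct.map (A.ρ g) (B.ρ g) (a' ⊗ₜ B.ρ g⁻¹ b)
  simp [TensorProduct.map_tmul, ← TensorProduct.sum_tmul, h]

lemma invariant_of_d_eq_zero (A : Rep.{u} R G) (x : (Fin 0 → G) → A.V)
    (hx : (inhomogeneousCochains.d A 0).hom x = 0) (g : G) : A.ρ g (x default) = x default := by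
  have h := congrFun hx fun _ => g
  rw [inhomogeneousCochains.d_hom_apply] at h
  simp only [Subsingleton.elim _ (default : Fin 0 → G)] at h
  refine sub_eq_zero.1 (Eq.trans ?_ h)
  simp [sub_eq_add_neg]

/-- The invariant element of `A` given by a `0`-cocycle of the Tate complex. -/
def cocycleVal (A : Rep.{u} R G) : (tateComplex A).cycles 0 →+ A.ρ.invariants where
  toFun z := ⟨((tateComplex A).iCycles 0).hom z default, fun g => by
    have h1 : ((tateComplex A).d 0 1).hom (((tateComplex A).iCycles 0).hom z) = 0 := by
      rw [← LinearMap.comp_apply, ← ModuleCat.hom_comp, HomologicalComplex.iCycles_d]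
      rfl
    have h2 : (inhomogeneousCochains.d A 0).hom (((tateComplex A).iCycles 0).hom z) = 0 := by
      rw [← inhomogeneousCochains.d_def]
      exact h1
    exact invariant_of_d_eq_zero A _ h2 g⟩
  map_zero' := by
    refine Subtype.ext ?_
    change ((tateComplex A).iCycles 0).hom 0 default = _
    rw [map_zero]
    rfl
  map_add' x y := by
    refine Subtype.ext ?_
    change ((tateComplex A).iCycles 0).hom (x + y) default = _
    rw [map_add]
    rfl

lemma tateNorm_apply (A : Rep.{u} R G) (c : (Fin 0 → G) →₀ A.V) :
    (Rep.tateNorm A).hom c default = ∑ g : G, A.ρ g (c default) := by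
  rw [Rep.tateNorm_eq, Finsupp.unique_single c]
  simp [Representation.norm]

lemma cocycleVal_toCycles (A : Rep.{u} R G) (c : (tateComplex A).X (-1)) :
    ∃ a' : A.V, (cocycleVal A (((tateComplex A).toCycles (-1) 0).hom c)).1 = ∑ g : G, A.ρ g a' := by
  refine ⟨(show (Fin 0 → G) →₀ A.V from c) default, ?_⟩
  refine Eq.trans ?_ (tateNorm_apply A c)
  change ((tateComplex A).iCycles 0).hom (((tateComplex A).toCycles (-1) 0).hom c) default = _
  rw [← LinearMap.comp_apply, ← ModuleCat.hom_comp, HomologicalComplex.toCycles_i]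
  rfl

/-- The pairing of `0`-cocycles with `H^s(G, B)`: `a ∈ A^G` acts by the map induced by
`b ↦ a ⊗ b`. -/
def cupCocycle (A B : Rep.{u} R G) (s : ℤ) :
    (tateComplex A).cycles 0 →+ tateCohomology B s →+ tateCohomology (A ⊗ B) s :=
  AddMonoidHom.mk' (fun z =>
    ((tateCohomologyFunctor s).map (tmulLeft B (cocycleVal A z))).hom.toAddMonoidHom) fun x y => by
      rw [map_add, tmulLeft_add, Functor.map_add]
      rfl

lemma ker_homologyπ_le (A B : Rep.{u} R G) (s : ℤ) :
    ((tateComplex A).homologyπ 0).hom.toAddMonoidHom.ker ≤ (cupCocycle A B s).ker := by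
  intro z hz
  have hex : (ShortComplex.mk _ _ ((tateComplex A).toCycles_comp_homologyπ (-1) 0)).Exact :=
    ShortComplex.exact_of_g_is_cokernel _ ((tateComplex A).homologyIsCokernel (-1) 0 (by simp))
  obtain ⟨c, rfl⟩ := (ShortComplex.moduleCat_exact_iff _).1 hex z hz
  obtain ⟨a', ha'⟩ := cocycleVal_toCycles A c
  change ((tateCohomologyFunctor s).map (tmulLeft B (cocycleVal A _))).hom.toAddMonoidHom = 0
  rw [tmulLeft_norm B _ a' ha', tateMap_normHom]
  rfl

/-- The cup product `H^0(G, A) × H^s(G, B) → H^s(G, A ⊗ B)`: the class of `a ∈ A^G` acts by the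
map induced by `b ↦ a ⊗ b`. -/
def cupZero (A B : Rep.{u} R G) (s : ℤ) :
    tateCohomology A 0 →+ tateCohomology B s →+ tateCohomology (A ⊗ B) s :=
  AddMonoidHom.liftOfSurjective ((tateComplex A).homologyπ 0).hom.toAddMonoidHom
    ((ModuleCat.epi_iff_surjective _).1 inferInstance)
    ⟨cupCocycle A B s, ker_homologyπ_le A B s⟩

/-- The cup product in degrees `r = n ≥ 0` and `s`, by recursion on `n`: in degree `0` it is
`cupZero`, and `(δ a) ⌣ b = δ (a ⌣ b)` for the connecting isomorphisms `δ` of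
`0 → A → R[G] ⊗ A → J_G ⊗ A → 0` and its tensor product with `B`. -/
def cupNonneg : ∀ (n : ℕ) (A B : Rep.{u} R G) (r s t : ℤ), r = n → r + s = t →
    (tateCohomology A r →+ tateCohomology B s →+ tateCohomology (A ⊗ B) t)
  | 0, A, B, r, s, t, hr, ht => by
    obtain rfl : r = 0 := hr
    obtain rfl : s = t := by lia
    exact cupZero A B s
  | n + 1, A, B, r, s, t, hr, ht =>
    (AddMonoidHom.compHom (((tateCohomologyFunctor (t - 1)).map (α_ _ A B).hom ≫
        (shiftUp (A ⊗ B) (t - 1) t (by lia)).hom).hom.toAddMonoidHom)).comp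
      ((cupNonneg n (coaugQuot R G ⊗ A) B (r - 1) s (t - 1) (by lia) (by lia)).comp
        (shiftUp A (r - 1) r (by lia)).inv.hom.toAddMonoidHom)

/-- The cup product in degrees `r = -n ≤ 0` and `s`, by recursion on `n`: in degree `0` it is
`cupZero`, and `δ (a ⌣ b) = (δ a) ⌣ b` for the connecting isomorphisms `δ` of
`0 → I_G ⊗ A → R[G] ⊗ A → A → 0` and its tensor product with `B`. -/
def cupNonpos : ∀ (n : ℕ) (A B : Rep.{u} R G) (r s t : ℤ), r = -n → r + s = t →
    (tateCohomology A r →+ tateCohomology B s →+ tateCohomology (A ⊗ B) t)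
  | 0, A, B, r, s, t, hr, ht => by
    obtain rfl : r = 0 := by simpa using hr
    obtain rfl : s = t := by lia
    exact cupZero A B s
  | n + 1, A, B, r, s, t, hr, ht =>
    (AddMonoidHom.compHom (((tateCohomologyFunctor (t + 1)).map (α_ _ A B).hom ≫
        (shiftDown (A ⊗ B) t (t + 1) rfl).inv).hom.toAddMonoidHom)).comp
      ((cupNonpos n (augIdeal R G ⊗ A) B (r + 1) s (t + 1) (by lia) (by lia)).comp
        (shiftDown A r (r + 1) rfl).hom.hom.toAddMonoidHom)

/-- The cup product `H^r(G, A) × H^s(G, B) → H^t(G, A ⊗ B)`, `t = r + s`, on Tate cohomology in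
all degrees: the biadditive pairing which in degree `r = 0` is `cupZero` and satisfies
`(δ a) ⌣ b = δ (a ⌣ b)` for the dimension shifts in the first variable. -/
def cup (A B : Rep.{u} R G) (r s t : ℤ) (h : r + s = t) :
    tateCohomology A r →+ tateCohomology B s →+ tateCohomology (A ⊗ B) t :=
  if hr : 0 ≤ r then cupNonneg r.toNat A B r s t (by lia) h
  else cupNonpos (-r).toNat A B r s t (by lia) h

lemma augSeq_shortExact : (augSeq R G).ShortExact :=
  shortExact_of (S := augSeq R G) Subtype.val_injective
    (fun r => ⟨MonoidAlgebra.single 1 r, aug_single _ _⟩) fun y hy => ⟨⟨y, hy⟩, rfl⟩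

section Splitting

variable {A : Rep.{u} R G} (φ : cocycles₂ A)

open Classical in
/-- The symbols `x_σ` of the splitting module, with `x_1 = φ(1, 1)`. -/
def splitX (σ : G) : A.V × ({σ : G // σ ≠ 1} →₀ R) :=
  if h : σ = 1 then (φ (1, 1), 0) else (0, Finsupp.single ⟨σ, h⟩ 1)

/-- The action of `g` on the splitting module: the given one on `A`, and
`g • x_τ = x_{g τ} - x_g + φ(g, τ)`. -/
def splitAct (g : G) :
    (A.V × ({σ : G // σ ≠ 1} →₀ R)) →ₗ[R] (A.V × ({σ : G // σ ≠ 1} →₀ R)) :=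
  LinearMap.coprod (LinearMap.inl R _ _ ∘ₗ A.ρ g)
    (Finsupp.linearCombination R fun τ : {σ : G // σ ≠ 1} =>
      splitX φ (g * τ.1) - splitX φ g + (φ (g, τ.1), 0))

lemma splitX_one : splitX φ 1 = (φ (1, 1), 0) := by simp [splitX]

lemma splitX_of_ne (σ : {σ : G // σ ≠ 1}) : splitX φ σ.1 = (0, Finsupp.single σ 1) := by
  simp [splitX, σ.2]

lemma splitAct_inl (g : G) (a : A.V) : splitAct φ g (a, 0) = (A.ρ g a, 0) := by
  simp [splitAct]

lemma splitAct_splitX (g τ : G) :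
    splitAct φ g (splitX φ τ) = splitX φ (g * τ) - splitX φ g + (φ (g, τ), 0) := by
  by_cases h : τ = 1
  · subst h
    rw [splitX_one, splitAct_inl, mul_one, sub_self, zero_add, cocycles₂_map_one_snd φ g]
  · rw [splitX_of_ne φ ⟨τ, h⟩]
    simp [splitAct]

lemma split_hom_ext {N : Type*} [AddCommGroup N] [Module R N]
    {f f₁ : (A.V × ({σ : G // σ ≠ 1} →₀ R)) →ₗ[R] N} (h : ∀ a : A.V, f (a, 0) = f₁ (a, 0))
    (hx : ∀ σ : G, f (splitX φ σ) = f₁ (splitX φ σ)) : f = f₁ := by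
  refine LinearMap.prod_ext (LinearMap.ext h) (Finsupp.lhom_ext' fun σ => LinearMap.ext_ring ?_)
  have := hx σ.1
  rwa [splitX_of_ne] at this

/-- The splitting module `C(φ) = A ⊕ ⨁_{σ ≠ 1} R x_σ` of a `2`-cocycle `φ`. -/
def splitMod : Rep.{u} R G :=
  Rep.of (X := A.V × ({σ : G // σ ≠ 1} →₀ R))
    { toFun := splitAct φ
      map_one' := by
        refine split_hom_ext φ (fun a => ?_) fun σ => ?_
        · simp [splitAct_inl]
        · rw [splitAct_splitX, one_mul, splitX_one, cocycles₂_map_one_fst φ σ]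
          simp
      map_mul' := fun g h => by
        refine split_hom_ext φ (fun a => ?_) fun σ => ?_
        · simp [splitAct_inl]
        · rw [Module.End.mul_apply, splitAct_splitX, splitAct_splitX, map_add, map_sub,
            splitAct_splitX, splitAct_splitX, splitAct_inl, mul_assoc]
          have h1 := (mem_cocycles₂_iff _).1 φ.2 g h σ
          have h2 : ((φ (g * h, σ), 0) : A.V × ({σ : G // σ ≠ 1} →₀ R)) + (φ (g, h), 0) =
              (A.ρ g (φ (h, σ)), 0) + (φ (g, h * σ), 0) := by
            rw [Prod.mk_add_mk, Prod.mk_add_mk]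
            exact congrArg (fun t => (t, _)) h1
          rw [← eq_sub_iff_add_eq] at h2
          rw [h2]
          abel }

/-- The inclusion of `A` in the splitting module. -/
def splitIncl : A ⟶ splitMod φ :=
  Rep.ofHom (σ := (splitMod φ).ρ) ⟨LinearMap.inl R _ _, fun g => by
    ext a : 1
    exact (splitAct_inl φ g a).symm⟩

/-- The element `σ - 1` of `I_G`. -/
def augGen (σ : G) : (augIdeal R G).V :=
  ⟨MonoidAlgebra.single σ 1 - MonoidAlgebra.single 1 1, by
    rw [LinearMap.mem_ker]
    refine (map_sub (aug R G).hom (MonoidAlgebra.single σ 1) (MonoidAlgebra.single 1 1)).trans ?_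
    rw [aug_single, aug_single]
    exact sub_self (1 : R)⟩

/-- The map `α : C(φ) → I_G` with `α = 0` on `A` and `α(x_σ) = σ - 1`, as a linear map. -/
def splitProjLin : (A.V × ({σ : G // σ ≠ 1} →₀ R)) →ₗ[R] (augIdeal R G).V :=
  (Finsupp.linearCombination R fun σ : {σ : G // σ ≠ 1} => augGen σ.1) ∘ₗ LinearMap.snd R _ _

lemma splitProjLin_splitX (σ : G) : splitProjLin (splitX φ σ) = augGen σ := by
  by_cases h : σ = 1
  · subst h
    rw [splitX_one]
    refine Subtype.ext (Eq.trans ?_ (sub_self _).symm)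
    simp [splitProjLin]
    rfl
  · rw [splitX_of_ne φ ⟨σ, h⟩]
    simp [splitProjLin]

lemma augIdeal_ρ_augGen (g σ : G) :
    (augIdeal R G).ρ g (augGen σ) = augGen (g * σ) - augGen g := by
  refine Subtype.ext ?_
  change Representation.ofMulAction R G G g (MonoidAlgebra.single σ 1 - MonoidAlgebra.single 1 1) =
    (MonoidAlgebra.single (g * σ) 1 - MonoidAlgebra.single 1 1) -
      (MonoidAlgebra.single g 1 - MonoidAlgebra.single 1 1)
  rw [map_sub, Representation.ofMulAction_single, Representation.ofMulAction_single]
  simp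

/-- The map `α : C(φ) → I_G` with `α = 0` on `A` and `α(x_σ) = σ - 1`. -/
def splitProj : splitMod φ ⟶ augIdeal R G :=
  Rep.ofHom (ρ := (splitMod φ).ρ) ⟨splitProjLin, fun g => by
    refine split_hom_ext φ (fun a => ?_) fun σ => ?_
    · change splitProjLin (splitAct φ g (a, 0)) = (augIdeal R G).ρ g (splitProjLin (a, 0))
      rw [splitAct_inl]
      simp [splitProjLin]
    · change splitProjLin (splitAct φ g (splitX φ σ)) =
        (augIdeal R G).ρ g (splitProjLin (splitX φ σ))
      rw [splitAct_splitX, splitProjLin_splitX, augIdeal_ρ_augGen, map_add, map_sub,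
        splitProjLin_splitX, splitProjLin_splitX]
      simp [splitProjLin]⟩

/-- `0 → A → C(φ) → I_G → 0`. -/
def splitSeq : ShortComplex (Rep.{u} R G) where
  X₁ := A
  X₂ := splitMod φ
  X₃ := augIdeal R G
  f := splitIncl φ
  g := splitProj φ
  zero := by
    ext : 2
    refine LinearMap.ext fun a => ?_
    change splitProjLin (a, 0) = 0
    simp [splitProjLin]

lemma splitProjLin_val (z : A.V × ({σ : G // σ ≠ 1} →₀ R)) (σ : {σ : G // σ ≠ 1}) :
    MonoidAlgebra.coeffLinearEquiv R (splitProjLin z).1 σ.1 = z.2 σ := by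
  classical
  have h : Finsupp.lapply σ.1 ∘ₗ (MonoidAlgebra.coeffLinearEquiv R).toLinearMap ∘ₗ
      (LinearMap.ker (aug R G).hom.toLinearMap).subtype ∘ₗ splitProjLin =
      Finsupp.lapply σ ∘ₗ LinearMap.snd R A.V ({σ : G // σ ≠ 1} →₀ R) := by
    refine LinearMap.prod_ext (LinearMap.ext fun a => ?_)
      (Finsupp.lhom_ext' fun τ => LinearMap.ext_ring ?_)
    · change MonoidAlgebra.coeffLinearEquiv R (splitProjLin (a, 0)).1 σ.1 = 0
      rw [show splitProjLin (a, (0 : {σ : G // σ ≠ 1} →₀ R)) = 0 by simp [splitProjLin]]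
      exact DFunLike.congr_fun (map_zero (MonoidAlgebra.coeffLinearEquiv (M := G) (S := R) R)) σ.1
    · change MonoidAlgebra.coeffLinearEquiv R
        (splitProjLin ((0 : A.V), Finsupp.single τ 1)).1 σ.1 = Finsupp.single τ 1 σ
      rw [show splitProjLin ((0 : A.V), Finsupp.single τ (1 : R)) = augGen τ.1 by
        simp [splitProjLin]]
      change MonoidAlgebra.coeffLinearEquiv R
        (MonoidAlgebra.single τ.1 1 - MonoidAlgebra.single 1 1) σ.1 = _
      rw [map_sub]
      simp [Finsupp.single_apply, Subtype.ext_iff, σ.2.symm]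
  exact LinearMap.congr_fun h z

lemma splitProjLin_surj (φ : cocycles₂ A) (y : MonoidAlgebra R G) :
    ∃ z : A.V × ({σ : G // σ ≠ 1} →₀ R), (splitProjLin z).1 =
      y - (show R from (aug R G).hom y) • MonoidAlgebra.single 1 1 := by
  induction y using MonoidAlgebra.induction_linear with
  | zero =>
    refine ⟨0, ?_⟩
    rw [map_zero, show (aug R G).hom (0 : MonoidAlgebra R G) = (0 : R) from map_zero (aug R G).hom,
      zero_smul, sub_zero]
    rfl
  | add x y hx hy =>
    obtain ⟨z, hz⟩ := hx
    obtain ⟨w, hw⟩ := hy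
    refine ⟨z + w, ?_⟩
    rw [map_add]
    refine (congrArg₂ (· + ·) hz hw).trans ?_
    rw [show (aug R G).hom (x + y) = ((show R from (aug R G).hom x) + (aug R G).hom y : R) from
      map_add (aug R G).hom x y, add_smul]
    abel
  | single σ r =>
    refine ⟨r • splitX φ σ, ?_⟩
    rw [map_smul, splitProjLin_splitX]
    change r • (MonoidAlgebra.single σ 1 - MonoidAlgebra.single 1 1) = _
    rw [show (aug R G).hom (MonoidAlgebra.single σ r) = r from aug_single σ r, smul_sub]
    simp

lemma splitSeq_shortExact : (splitSeq φ).ShortExact := by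
  refine shortExact_of (S := splitSeq φ) (fun a b h => congrArg Prod.fst h) (fun y => ?_)
    fun z hz => ⟨z.1, Prod.ext rfl (Finsupp.ext fun σ => ?_)⟩
  · obtain ⟨z, hz⟩ := splitProjLin_surj φ y.1
    refine ⟨z, Subtype.ext (hz.trans ?_)⟩
    rw [show (aug R G).hom y.1 = (0 : R) from y.2, zero_smul, sub_zero]
  · refine Eq.trans ?_ (splitProjLin_val z σ)
    rw [show splitProjLin z = 0 from hz]
    exact (DFunLike.congr_fun (map_zero (MonoidAlgebra.coeffLinearEquiv (M := G) (S := R) R)) σ.1).symm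

/-- The inverse of the reciprocity map, attached to a `2`-cocycle `φ`: the composite `H^{-2}(G, R) → H^{-1}(G, I_G) → H^0(G, A)` of the connecting homomorphisms of
`0 → I_G → R[G] → R → 0` and of `0 → A → C(φ) → I_G → 0`. -/
def reciprocityInv : tateCohomology (Rep.trivial R G R) (-2) ⟶ tateCohomology A 0 :=
  (TateCohomology.map_tateComplexFunctor_shortExact (augSeq_shortExact (R := R) (G := G))).δ
      (-2) (-1) (by simp) ≫
    (TateCohomology.map_tateComplexFunctor_shortExact (splitSeq_shortExact φ)).δ (-1) 0 (by simp)

/-- The class of a `2`-cocycle in the Tate cohomology group `H^2(G, A)`. -/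
def tateClass : tateCohomology A 2 :=
  ((TateCohomology.isoGroupCohomology 2).inv.app A).hom (H2π A φ)

end Splitting

/-- The cup product `H^r(G, A) × H^s(G, R) → H^t(G, A)`, `t = r + s`, through `A ⊗ R ≅ A`. -/
def cupUnit (A : Rep.{u} R G) (r s t : ℤ) (h : r + s = t) :
    tateCohomology A r →+ tateCohomology (Rep.trivial R G R) s →+ tateCohomology A t :=
  (AddMonoidHom.compHom
    ((tateCohomologyFunctor t).map (ρ_ A).hom).hom.toAddMonoidHom).comp
      (cup A (𝟙_ (Rep.{u} R G)) r s t h)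

end TateCup

end

noncomputable section

namespace TateCup
open CategoryTheory MonoidalCategory groupHomology groupCohomology
open Limits TensorProduct

universe u
variable {R G : Type u} [CommRing R] [Group G] [Fintype G]

/-! Write `J` for `coaugQuot R G`. Since `R[G] ⊗ A` is acyclic, the cocycle `φ` becomes a coboundary
there: `φ = dχ₁`. The image of `χ₁` in `J ⊗ A` is a `1`-cocycle, which in turn becomes `dχ₀` in
`R[G] ⊗ (J ⊗ A)`, and the image of `χ₀` in `J ⊗ (J ⊗ A)` is an invariant element `a`. Hence `[φ] =
δδ[a]`, and the rule `(δu) ⌣ v = δ(u ⌣ v)` gives `[φ] ⌣ x = δδ(a_* x)`, where `a_*` is induced by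
the map `R → J ⊗ (J ⊗ A)`, `1 ↦ a`.

The same two cochains map the two sequences defining `reciprocityInv` to the two dimension-shifting
sequences. Sending `1 ∈ R[G]` to `χ₀` maps the augmentation sequence; it is `a_*` on `R`, and on
`I_G` it sends `σ - 1` to the class of `χ₁(σ)`, because `σχ₀ - χ₀ = (dχ₀)(σ)`. Sending `x_σ` to
`χ₁(σ)` maps the splitting sequence; it is the identity on `A` up to the unitor, equivariant
precisely because `dχ₁ = φ`, and induces that same map on `I_G`. Naturality of `δ` for both ladders
turns the composite of connecting maps into `δδ(a_* x)`.

The ladders are `exists_augSeq_hom` and `exists_splitSeq_hom`; `exists_d_eq_tensorIncl` produces the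
cochains, `shiftUp_homologyπ` identifies `[φ]` with `δδ[a]`, and `cupUnit_two_shiftUp` evaluates the
cup product. -/

/-! ### Tate classes and connecting maps in terms of cochains -/

/-- The connecting homomorphism, on classes of cycles. -/
lemma δ_homologyπ {S : ShortComplex (CochainComplex (ModuleCat.{u} R) ℤ)} (hS : S.ShortExact)
    (i j : ℤ) (hij : i + 1 = j) (z : S.X₃.cycles i) (y : S.X₂.X i)
    (hy : (S.g.f i).hom y = (S.X₃.iCycles i).hom z) (w : S.X₁.cycles j)
    (hw : (S.f.f j).hom ((S.X₁.iCycles j).hom w) = (S.X₂.d i j).hom y) :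
    (hS.δ i j hij).hom ((S.X₃.homologyπ i).hom z) = (S.X₁.homologyπ j).hom w := by
  -- `δ_apply'` takes its lift in the opcycles of the middle complex, so the cochain `y` enters
  -- through its class there.
  refine hS.δ_apply' i j hij _ ((S.X₂.pOpcycles i).hom y) _ ?_ ?_
  · change (S.X₂.pOpcycles i ≫ HomologicalComplex.opcyclesMap S.g i).hom y =
      (S.X₃.homologyπ i ≫ S.X₃.homologyι i).hom z
    rw [HomologicalComplex.p_opcyclesMap, HomologicalComplex.homology_π_ι]
    exact congrArg (S.X₃.pOpcycles i).hom hy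
  · apply (ModuleCat.mono_iff_injective (S.X₂.iCycles j)).1 inferInstance
    change (HomologicalComplex.cyclesMap S.f j ≫ S.X₂.iCycles j).hom w =
      (S.X₂.pOpcycles i ≫ S.X₂.opcyclesToCycles i j ≫ S.X₂.iCycles j).hom y
    rw [HomologicalComplex.cyclesMap_i, HomologicalComplex.pOpcycles_opcyclesToCycles_assoc,
      HomologicalComplex.toCycles_i]
    exact hw

/-- A cochain with vanishing differential is a cocycle of the Tate complex. -/
lemma exists_cycles (A : Rep.{u} R G) (n : ℕ) (x : (Fin n → G) → A.V)
    (hx : (inhomogeneousCochains.d A n).hom x = 0) :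
    ∃ z : (tateComplex A).cycles n, ((tateComplex A).iCycles n).hom z = x := by
  have hex : (ShortComplex.mk _ _ ((tateComplex A).iCycles_d n (n + 1))).Exact :=
    ShortComplex.exact_of_f_is_kernel _ ((tateComplex A).cyclesIsKernel n (n + 1) (by simp))
  refine (ShortComplex.moduleCat_exact_iff _).1 hex x ?_
  change ((inhomogeneousCochains A).d n (n + 1)).hom x = 0
  rwa [inhomogeneousCochains.d_def]

/-- The identity of `R[G] ⊗ M` is a norm. -/
lemma exists_normHom_eq_id (M : Rep.{u} R G) :
    ∃ f : (Rep.leftRegular R G ⊗ M).V →ₗ[R] (Rep.leftRegular R G ⊗ M).V,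
      normHom (A := Rep.leftRegular R G ⊗ M) (B := Rep.leftRegular R G ⊗ M) f = 𝟙 _ := by
  classical
  -- `p` projects `R[G]` onto the line of `1`; its conjugate by `g` projects onto the line of `g`,
  -- and these projections sum to the identity.
  let p : (Rep.leftRegular R G).V →ₗ[R] (Rep.leftRegular R G).V :=
    (MonoidAlgebra.coeffLinearEquiv R).symm.toLinearMap ∘ₗ Finsupp.lsingle (1 : G) ∘ₗ
      Finsupp.lapply (1 : G) ∘ₗ (MonoidAlgebra.coeffLinearEquiv R).toLinearMap
  refine ⟨LinearMap.rTensor M.V p, ?_⟩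
  ext : 2
  refine TensorProduct.ext' fun x m => ?_
  refine (normHom_apply _ _).trans ?_
  change ∑ g : G, TensorProduct.map (Representation.ofMulAction R G G g) (M.ρ g)
    (LinearMap.rTensor M.V p (TensorProduct.map (Representation.ofMulAction R G G g⁻¹)
      (M.ρ g⁻¹) (x ⊗ₜ m))) = x ⊗ₜ m
  simp only [TensorProduct.map_tmul, LinearMap.rTensor_tmul, Representation.self_inv_apply,
    ← TensorProduct.sum_tmul]
  congr 1
  induction x using MonoidAlgebra.induction_linear with
  | zero => simp
  | add x y hx hy => simp only [map_add, Finset.sum_add_distrib, hx, hy]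
  | single h r =>
    have hp : ∀ (a : G), p (MonoidAlgebra.single a r) =
        if a = 1 then MonoidAlgebra.single (1 : G) r else 0 := fun a => by
      simp only [p, LinearMap.comp_apply, LinearEquiv.coe_coe,
        Finsupp.lapply_apply, Finsupp.lsingle_apply]
      split_ifs with h
      · subst h; simp
      · simp [h]
    simp only [Representation.ofMulAction_single, hp, smul_eq_mul, apply_ite, map_zero, mul_one,
      inv_mul_eq_one]
    simp

/-- Positive-degree cocycles with values in `R[G] ⊗ M` are coboundaries. -/
lemma exists_d_eq (M : Rep.{u} R G) (n : ℕ)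
    (ψ : (Fin (n + 1) → G) → (Rep.leftRegular R G ⊗ M).V)
    (hψ : (inhomogeneousCochains.d (Rep.leftRegular R G ⊗ M) (n + 1)).hom ψ = 0) :
    ∃ χ, (inhomogeneousCochains.d (Rep.leftRegular R G ⊗ M) n).hom χ = ψ := by
  obtain ⟨f, hf⟩ := exists_normHom_eq_id M
  -- With `normHom f = 𝟙`, `hCo_spec` says that `hCo f` is a contracting homotopy; on a cocycle only
  -- the term `d (hCo f ψ)` survives.
  refine ⟨hCo f n ψ, funext fun g => ?_⟩
  have h := hCo_spec f n ψ g
  rw [hψ, map_zero, hf] at h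
  exact (zero_add _).symm.trans h

lemma d_comp_hom {A B : Rep.{u} R G} (f : A ⟶ B) (n : ℕ) (x : (Fin n → G) → A.V)
    (g : Fin (n + 1) → G) :
    (inhomogeneousCochains.d B n).hom (fun h => f.hom (x h)) g =
      f.hom ((inhomogeneousCochains.d A n).hom x g) := by
  simp only [inhomogeneousCochains.d_hom_apply, map_add, map_sum, map_smul]
  congr 1
  exact (Rep.hom_comm_apply f _ _).symm

/-- The comparison isomorphism is built by restricting the Tate complex to degrees `≥ 0`, where it
is the complex of inhomogeneous cochains. On cocycles it therefore leaves the underlying cochain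
unchanged, which is all that is needed to represent `tateClass φ` by `φ` itself. -/
lemma exists_cyclesMap_homologyIsoPos (A : Rep.{u} R G) (n : ℕ) [NeZero n] :
    ∃ e : (tateComplex A).cycles n ⟶ (inhomogeneousCochains A).cycles n,
      e ≫ (inhomogeneousCochains A).iCycles n = (tateComplex A).iCycles n ∧
      (tateComplex A).homologyπ n ≫ ((TateCohomology.isoGroupCohomology n).hom.app A) =
        e ≫ (inhomogeneousCochains A).homologyπ n := by
  refine ⟨((tateComplex A).restrictionCyclesIso (ComplexShape.embeddingUpIntGE 0) n (n + 1)
      (by simp) (j' := n) (k' := (n : ℤ) + 1) (by simp) (by simp) (by simp)).inv ≫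
    HomologicalComplex.cyclesMap (tateComplexConnectData A).restrictionGEIso.hom n, ?_, ?_⟩
  · rw [Category.assoc, HomologicalComplex.cyclesMap_i,
      HomologicalComplex.restrictionCyclesIso_inv_iCycles_assoc]
    rw [CochainComplex.ConnectData.restrictionGEIso_hom_f]
    exact (congrArg _ (Iso.inv_hom_id _)).trans (Category.comp_id _)
  · change _ ≫ ((tateComplexConnectData A).homologyIsoPos n n rfl).hom = _
    rw [CochainComplex.ConnectData.homologyIsoPos, Iso.trans_hom, Iso.symm_hom,
      HomologicalComplex.homologyπ_restrictionHomologyIso_inv_assoc, Category.assoc]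
    congr 1
    exact HomologicalComplex.homologyπ_naturality _ _

/-- The Tate class of a `2`-cocycle is the class of the corresponding inhomogeneous cochain. -/
lemma exists_cycles_tateClass {A : Rep.{u} R G} (φ : cocycles₂ A) :
    ∃ z : (tateComplex A).cycles 2, ((tateComplex A).homologyπ 2).hom z = tateClass φ ∧
      ((tateComplex A).iCycles 2).hom z = fun g : Fin 2 → G => φ (g 0, g 1) := by
  let c := (isoCocycles₂ A).inv.hom φ
  have hc : (iCocycles A 2).hom c = fun g : Fin 2 → G => φ (g 0, g 1) :=
    (congrArg (fun f => f.hom φ) (isoCocycles₂_inv_comp_iCocycles A)).trans rfl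
  obtain ⟨e, he, he'⟩ := exists_cyclesMap_homologyIsoPos A 2
  obtain ⟨z, hz⟩ := exists_cycles A 2 ((iCocycles A 2).hom c) (by
    rw [← inhomogeneousCochains.d_def]
    exact congrArg (fun f => f.hom c) ((inhomogeneousCochains A).iCycles_d 2 3))
  have hez : e.hom z = c :=
    (ModuleCat.mono_iff_injective ((inhomogeneousCochains A).iCycles 2)).1 inferInstance
      ((congrArg (fun f => f.hom z) he).trans hz)
  refine ⟨z, ?_, hz.trans hc⟩
  -- `tateClass` is defined by the inverse of the comparison isomorphism, so the classes are
  -- compared after applying the isomorphism itself.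
  have h1 : ((TateCohomology.isoGroupCohomology 2).hom.app A).hom
      (((tateComplex A).homologyπ 2).hom z) = H2π A φ :=
    (congrArg (fun f => f.hom z) he').trans (congrArg (groupCohomology.π A 2).hom hez)
  rw [tateClass, ← h1]
  exact (congrArg (fun f => f.hom (((tateComplex A).homologyπ 2).hom z))
    ((TateCohomology.isoGroupCohomology 2).hom_inv_id_app A)).symm

/-! ### Naturality of dimension shifting and its effect on cup products -/

lemma δ_naturality {S S' : ShortComplex (Rep.{u} R G)}
    (h : (S.map (tateComplexFunctor R G)).ShortExact)
    (h' : (S'.map (tateComplexFunctor R G)).ShortExact) (F : S ⟶ S') (i j : ℤ) (hij : i + 1 = j) :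
    h.δ i j hij ≫ (tateCohomologyFunctor j).map F.τ₁ =
      (tateCohomologyFunctor i).map F.τ₃ ≫ h'.δ i j hij :=
  HomologicalComplex.HomologySequence.δ_naturality
    ((tateComplexFunctor R G).mapShortComplex.map F) h h' i j hij

/-- Whiskering by `f` is a map of the tensored sequences by the interchange law. The case `f = (ρ_
A).hom` moves the identification `A ⊗ R ≅ A` past each dimension shift. -/
lemma shiftUp_naturality {M N : Rep.{u} R G} (f : M ⟶ N) (i j : ℤ) (hij : i + 1 = j) :
    (tateCohomologyFunctor i).map (coaugQuot R G ◁ f) ≫ (shiftUp N i j hij).hom =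
      (shiftUp M i j hij).hom ≫ (tateCohomologyFunctor j).map f := by
  let F : (coaugSeq R G).map (tensorRight M) ⟶ (coaugSeq R G).map (tensorRight N) :=
    { τ₁ := _ ◁ f
      τ₂ := _ ◁ f
      τ₃ := _ ◁ f
      comm₁₂ := whisker_exchange _ _
      comm₂₃ := whisker_exchange _ _ }
  have h := δ_naturality
    (TateCohomology.map_tateComplexFunctor_shortExact (coaugSeq_tensor M))
    (TateCohomology.map_tateComplexFunctor_shortExact (coaugSeq_tensor N)) F i j hij
  refine Eq.trans ?_ (congrArg (· ≫ (tateCohomologyFunctor j).map (λ_ N).hom) h).symm |>.trans ?_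
  · exact (Category.assoc _ _ _).symm
  · refine (Category.assoc _ _ _).trans (Eq.trans ?_ (Category.assoc _ _ _).symm)
    exact congrArg (_ ≫ ·) (((tateCohomologyFunctor j).map_comp _ _).symm.trans
      ((congrArg (tateCohomologyFunctor j).map (leftUnitor_naturality f)).trans
        ((tateCohomologyFunctor j).map_comp _ _)))

/-- The cup product with a dimension-shifted class. -/
lemma cupNonneg_shiftUp (n : ℕ) (A B : Rep.{u} R G) (r s t : ℤ) (hr : r = (n + 1 : ℕ))
    (ht : r + s = t) (u : tateCohomology (coaugQuot R G ⊗ A) (r - 1)) (x : tateCohomology B s) :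
    cupNonneg (n + 1) A B r s t hr ht ((shiftUp A (r - 1) r (by lia)).hom.hom u) x =
      (shiftUp (A ⊗ B) (t - 1) t (by lia)).hom.hom
        (((tateCohomologyFunctor (t - 1)).map (α_ _ A B).hom).hom
          (cupNonneg n (coaugQuot R G ⊗ A) B (r - 1) s (t - 1) (by lia) (by lia) u x)) := by
  have h : (shiftUp A (r - 1) r (by lia)).inv.hom ((shiftUp A (r - 1) r (by lia)).hom.hom u) = u :=
    congrArg (fun f => f.hom u) (shiftUp A (r - 1) r (by lia)).hom_inv_id
  refine Eq.trans ?_ (congrArg (fun v => (shiftUp (A ⊗ B) (t - 1) t (by lia)).hom.hom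
        (((tateCohomologyFunctor (t - 1)).map (α_ _ A B).hom).hom
          (cupNonneg n (coaugQuot R G ⊗ A) B (r - 1) s (t - 1) (by lia) (by lia) v x))) h)
  rfl

/-- The cup product with the trivial representation, on a dimension-shifted class. -/
lemma cupNonneg_shiftUp_unit (n : ℕ) (A : Rep.{u} R G) (r r' s t t' : ℤ) (hr : r = (n + 1 : ℕ))
    (ht : r + s = t) (hr' : r' + 1 = r) (ht' : t' + 1 = t)
    (u : tateCohomology (coaugQuot R G ⊗ A) r') (x : tateCohomology (𝟙_ (Rep.{u} R G)) s) :
    ((tateCohomologyFunctor t).map (ρ_ A).hom).hom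
        (cupNonneg (n + 1) A (𝟙_ _) r s t hr ht ((shiftUp A r' r hr').hom.hom u) x) =
      (shiftUp A t' t ht').hom.hom (((tateCohomologyFunctor t').map (ρ_ _).hom).hom
        (cupNonneg n (coaugQuot R G ⊗ A) (𝟙_ _) r' s t' (by lia) (by lia) u x)) := by
  -- The recursion for `cupNonneg` is written with `r - 1` and `t - 1`; independent `r'` and `t'`
  -- allow numerals as degrees later on.
  obtain rfl : r' = r - 1 := by lia
  obtain rfl : t' = t - 1 := by lia
  rw [cupNonneg_shiftUp]
  have h := shiftUp_naturality (ρ_ A).hom (t - 1) t (by lia)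
  have h' := (congrArg ((tateCohomologyFunctor (t - 1)).map (α_ (coaugQuot R G) A (𝟙_ _)).hom ≫ ·)
    h).symm.trans (Category.assoc _ _ _).symm
  -- By coherence, the associator followed by `J ◁ ρ_A` is the right unitor of `J ⊗ A`.
  rw [← Functor.map_comp, whiskerLeft_rightUnitor, Iso.hom_inv_id_assoc] at h'
  exact congrArg (fun f => f.hom
    (cupNonneg n (coaugQuot R G ⊗ A) (𝟙_ _) (r - 1) s (t - 1) (by lia) (by lia) u x)) h'

/-- The class of an invariant element acts by the map it induces. -/
lemma cupNonneg_zero_homologyπ (A B : Rep.{u} R G) (s : ℤ) (z : (tateComplex A).cycles 0)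
    (x : tateCohomology B s) :
    cupNonneg 0 A B 0 s s rfl (zero_add s) (((tateComplex A).homologyπ 0).hom z) x =
      ((tateCohomologyFunctor s).map (tmulLeft B (cocycleVal A z))).hom x := by
  change cupZero A B s (((tateComplex A).homologyπ 0).hom z) x = _
  have h : cupZero A B s (((tateComplex A).homologyπ 0).hom.toAddMonoidHom z) =
    cupCocycle A B s z := AddMonoidHom.liftOfRightInverse_comp_apply _ _ _ _ _
  exact congrArg (fun f => f x) h

/-- The connecting homomorphism of dimension shifting, on classes of cocycles. -/
lemma shiftUp_homologyπ (M : Rep.{u} R G) (n : ℕ)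
    (χ : (Fin n → G) → (Rep.leftRegular R G ⊗ M).V)
    (z : (tateComplex (coaugQuot R G ⊗ M)).cycles n)
    (hz : ((tateComplex (coaugQuot R G ⊗ M)).iCycles n).hom z =
      fun g => (((coaugSeq R G).map (tensorRight M)).g.hom (χ g)))
    (ψ : (Fin (n + 1) → G) → M.V)
    (hψ : (fun g => ((coaugSeq R G).map (tensorRight M)).f.hom ((λ_ M).inv.hom (ψ g))) =
      (inhomogeneousCochains.d _ n).hom χ)
    (w : (tateComplex M).cycles (n + 1 : ℕ))
    (hw : ((tateComplex M).iCycles (n + 1 : ℕ)).hom w = ψ) :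
    (shiftUp M n (n + 1 : ℕ) (by simp)).hom.hom
      (((tateComplex (coaugQuot R G ⊗ M)).homologyπ n).hom z) =
        ((tateComplex M).homologyπ (n + 1 : ℕ)).hom w := by
  -- The tensored sequence begins with `𝟙_ ⊗ M`, not `M`: `w` is moved there by the inverse unitor,
  -- and `h3` and `h4` cancel it against the unitor in `shiftUp`.
  let w' := (HomologicalComplex.cyclesMap (tateComplex.map (λ_ M).inv) (n + 1 : ℕ)).hom w
  have h := δ_homologyπ (TateCohomology.map_tateComplexFunctor_shortExact (coaugSeq_tensor M))
    n (n + 1 : ℕ) (by simp) z χ hz.symm w' (by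
      have h1 : ((tateComplex (𝟙_ _ ⊗ M)).iCycles (n + 1 : ℕ)).hom w' =
          fun g => (λ_ M).inv.hom (ψ g) := by
        rw [← hw]
        exact congrArg (fun f => f.hom w) (HomologicalComplex.cyclesMap_i
          (tateComplex.map (λ_ M).inv) (n + 1 : ℕ))
      refine (congrArg _ h1).trans (hψ.trans ?_)
      rw [← inhomogeneousCochains.d_def]
      rfl)
  refine (congrArg ((tateCohomologyFunctor (n + 1 : ℕ)).map (λ_ M).hom).hom h).trans ?_
  have h2 : (tateComplex (𝟙_ _ ⊗ M)).homologyπ (n + 1 : ℕ) ≫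
      (tateCohomologyFunctor (n + 1 : ℕ)).map (λ_ M).hom =
      HomologicalComplex.cyclesMap (tateComplex.map (λ_ M).hom) (n + 1 : ℕ) ≫
        (tateComplex M).homologyπ (n + 1 : ℕ) := HomologicalComplex.homologyπ_naturality _ _
  have h3 : HomologicalComplex.cyclesMap (tateComplex.map (λ_ M).inv) (n + 1 : ℕ) ≫
      HomologicalComplex.cyclesMap (tateComplex.map (λ_ M).hom) (n + 1 : ℕ) = 𝟙 _ := by
    rw [← HomologicalComplex.cyclesMap_comp]
    refine (congrArg (HomologicalComplex.cyclesMap · _)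
      (((tateComplexFunctor R G).mapIso (λ_ M)).inv_hom_id)).trans ?_
    exact HomologicalComplex.cyclesMap_id _ _
  have h4 : (HomologicalComplex.cyclesMap (tateComplex.map (λ_ M).hom) (n + 1 : ℕ)).hom w' = w :=
    congrArg (fun f => f.hom w) h3
  exact (congrArg (fun f => f.hom w') h2).trans
    (congrArg ((tateComplex M).homologyπ (n + 1 : ℕ)).hom h4)

/-! ### Low-degree cochains and the two maps of short exact sequences -/

lemma d_zero_apply (A : Rep.{u} R G) (x : (Fin 0 → G) → A.V) (g : Fin 1 → G) :
    (inhomogeneousCochains.d A 0).hom x g = A.ρ (g 0) (x default) - x default := by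
  rw [inhomogeneousCochains.d_hom_apply]
  simp only [Subsingleton.elim _ (default : Fin 0 → G)]
  simp [sub_eq_add_neg]

lemma d_one_apply (A : Rep.{u} R G) (x : (Fin 1 → G) → A.V) (g h : G) :
    (inhomogeneousCochains.d A 1).hom x ![g, h] =
      A.ρ g (x fun _ => h) - x (fun _ => g * h) + x fun _ => g := by
  rw [inhomogeneousCochains.d_hom_apply]
  have h0 : (fun i : Fin 1 => (![g, h] : Fin 2 → G) i.succ) = fun _ => h := by
    funext i; fin_cases i; rfl
  have h1 : Fin.contractNth (0 : Fin 2) (· * ·) ![g, h] = fun _ => g * h := by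
    funext i; fin_cases i; rfl
  have h2 : Fin.contractNth (1 : Fin 2) (· * ·) ![g, h] = fun _ => g := by
    funext i; fin_cases i; rfl
  rw [h0, Fin.sum_univ_two, h1, h2]
  simp
  abel

/-- The inclusion `m ↦ ∑ g ⊗ m` of `M` in `R[G] ⊗ M`. -/
abbrev tensorIncl (M : Rep.{u} R G) : M ⟶ Rep.leftRegular R G ⊗ M :=
  (λ_ M).inv ≫ ((coaugSeq R G).map (tensorRight M)).f

/-- The projection of `R[G] ⊗ M` to `J_G ⊗ M`. -/
abbrev tensorProj (M : Rep.{u} R G) : Rep.leftRegular R G ⊗ M ⟶ coaugQuot R G ⊗ M :=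
  ((coaugSeq R G).map (tensorRight M)).g

lemma tensorProj_tensorIncl (M : Rep.{u} R G) (m : M.V) :
    (tensorProj M).hom ((tensorIncl M).hom m) = 0 :=
  congrArg (fun f => f.hom ((λ_ M).inv.hom m)) ((coaugSeq R G).map (tensorRight M)).zero

/-- One dimension shift at the level of cochains: a primitive of `ψ` exists because `R[G] ⊗ M` is
acyclic, and it becomes a cocycle in `J ⊗ M` because its coboundary comes from `M`. -/
lemma exists_d_eq_tensorIncl (M : Rep.{u} R G) (n : ℕ) (ψ : (Fin (n + 1) → G) → M.V)
    (hψ : (inhomogeneousCochains.d M (n + 1)).hom ψ = 0) :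
    ∃ χ : (Fin n → G) → (Rep.leftRegular R G ⊗ M).V,
      (inhomogeneousCochains.d _ n).hom χ = (fun g => (tensorIncl M).hom (ψ g)) ∧
      (inhomogeneousCochains.d _ n).hom (fun g => (tensorProj M).hom (χ g)) = 0 := by
  obtain ⟨χ, h⟩ := exists_d_eq M n (fun g => (tensorIncl M).hom (ψ g)) (by
    funext g
    rw [d_comp_hom, hψ]
    exact map_zero (tensorIncl M).hom)
  refine ⟨χ, h, ?_⟩
  funext g
  rw [d_comp_hom, h]
  exact tensorProj_tensorIncl M _

/-- An element of `R[G] ⊗ M` with invariant image in `J_G ⊗ M` gives a map from the augmentation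
sequence. -/
lemma exists_augSeq_hom (M : Rep.{u} R G) (v : (Rep.leftRegular R G ⊗ M).V) (f : G → M.V)
    (hf : ∀ g, (Rep.leftRegular R G ⊗ M).ρ g v - v = (tensorIncl M).hom (f g)) :
    ∃ F : augSeq R G ⟶ (coaugSeq R G).map (tensorRight M),
      F.τ₃.hom (1 : R) = (tensorProj M).hom v ∧
      ∀ g, F.τ₁.hom (augGen g) = (λ_ M).inv.hom (f g) := by
  let S := (coaugSeq R G).map (tensorRight M)
  have hS : S.ShortExact := coaugSeq_tensor M
  have hinj : Function.Injective S.f.hom := (Rep.mono_iff_injective _).1 hS.mono_f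
  have hinv : ∀ g, (coaugQuot R G ⊗ M).ρ g ((tensorProj M).hom v) = (tensorProj M).hom v := by
    intro g
    have h := congrArg (tensorProj M).hom (hf g)
    rw [tensorProj_tensorIncl, map_sub, sub_eq_zero] at h
    exact (Rep.hom_comm_apply (tensorProj M) g v).symm.trans h
  let t₂ : Rep.leftRegular R G ⟶ Rep.leftRegular R G ⊗ M := Rep.leftRegularHom _ v
  have ht₂ : ∀ g, t₂.hom (MonoidAlgebra.single g 1) = (Rep.leftRegular R G ⊗ M).ρ g v := fun g =>
    (Rep.leftRegularHom_hom_single _ _ _).trans (one_smul _ _)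
  let t₃ : 𝟙_ (Rep.{u} R G) ⟶ coaugQuot R G ⊗ M :=
    Rep.ofHom (ρ := Representation.trivial R G R)
      ⟨LinearMap.toSpanSingleton R _ ((tensorProj M).hom v), fun g => by
        refine LinearMap.ext_ring ?_
        simp only [LinearMap.coe_comp, Function.comp_apply, LinearMap.toSpanSingleton_apply,
          Representation.trivial_apply, one_smul]
        exact (hinv g).symm⟩
  have ht₃ : t₃.hom (1 : R) = (tensorProj M).hom v := one_smul R _
  have h23 : t₂ ≫ S.g = aug R G ≫ t₃ := by
    ext : 2
    refine MonoidAlgebra.lhom_ext' fun g => LinearMap.ext_ring ?_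
    change (tensorProj M).hom (t₂.hom (MonoidAlgebra.single g 1)) =
      t₃.hom ((aug R G).hom (MonoidAlgebra.single g 1))
    rw [ht₂, aug_single, ht₃, Rep.hom_comm_apply]
    exact hinv g
  have hz : ((augSeq R G).f ≫ t₂) ≫ S.g = 0 := by
    refine (Category.assoc _ _ _).trans ((congrArg _ h23).trans ((Category.assoc _ _ _).symm.trans ?_))
    exact (congrArg (· ≫ t₃) (augSeq R G).zero).trans zero_comp
  have := hS.mono_f
  -- The left map is forced by `t₂`. Its value on `g - 1` is read off from `t₂ (g - 1) = g v - v`,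
  -- since the inclusion of `𝟙_ ⊗ M` is injective.
  let t₁ : augIdeal R G ⟶ 𝟙_ _ ⊗ M := hS.exact.lift _ hz
  have h12 : t₁ ≫ S.f = (augSeq R G).f ≫ t₂ := hS.exact.lift_f _ hz
  refine ⟨{ τ₁ := t₁, τ₂ := t₂, τ₃ := t₃, comm₁₂ := h12, comm₂₃ := h23 }, ht₃, fun g => hinj ?_⟩
  refine (congrArg (fun f => f.hom (augGen g)) h12).trans (Eq.trans ?_ (hf g))
  refine (map_sub t₂.hom (MonoidAlgebra.single g 1) (MonoidAlgebra.single 1 1)).trans ?_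
  rw [ht₂, ht₂, map_one]
  rfl

/-- A `1`-cochain in `R[G] ⊗ A` with coboundary `φ` gives a map from the splitting sequence. -/
lemma exists_splitSeq_hom {A : Rep.{u} R G} (φ : cocycles₂ A)
    (χ : (Fin 1 → G) → (Rep.leftRegular R G ⊗ A).V)
    (hχ : (inhomogeneousCochains.d _ 1).hom χ = fun g => (tensorIncl A).hom (φ (g 0, g 1)))
    (κ : augIdeal R G ⟶ coaugQuot R G ⊗ A)
    (hκ : ∀ g, κ.hom (augGen g) = (tensorProj A).hom (χ fun _ => g)) :
    ∃ F : splitSeq φ ⟶ (coaugSeq R G).map (tensorRight A), F.τ₁ = (λ_ A).inv ∧ F.τ₃ = κ := by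
  let ℓ : (A.V × ({σ : G // σ ≠ 1} →₀ R)) →ₗ[R] (Rep.leftRegular R G ⊗ A).V :=
    LinearMap.coprod (tensorIncl A).hom.toLinearMap
      (Finsupp.linearCombination R fun σ : {σ : G // σ ≠ 1} => χ fun _ => σ.1)
  have hd : ∀ g h, (Rep.leftRegular R G ⊗ A).ρ g (χ fun _ => h) - χ (fun _ => g * h) +
      χ (fun _ => g) = (tensorIncl A).hom (φ (g, h)) := fun g h => by
    rw [← d_one_apply, hχ]
    rfl
  have hA : ∀ a : A.V, ℓ (a, 0) = (tensorIncl A).hom a := fun a => by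
    refine (LinearMap.coprod_apply _ _ _).trans ?_
    rw [map_zero, add_zero]
    rfl
  have hX : ∀ σ : G, ℓ (splitX φ σ) = χ fun _ => σ := fun σ => by
    by_cases h : σ = 1
    · subst h
      -- Here `x_1 = φ(1, 1)` is not a basis vector; the relation `dχ = φ` at `(1, 1)` reduces to
      -- `χ(1) = φ(1, 1)`.
      rw [splitX_one, hA, ← hd, map_one, one_mul]
      simp
    · rw [splitX_of_ne φ ⟨σ, h⟩]
      refine (LinearMap.coprod_apply _ _ _).trans ?_
      simp
  let t₂ : splitMod φ ⟶ Rep.leftRegular R G ⊗ A :=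
    Rep.ofHom (ρ := (splitMod φ).ρ) ⟨ℓ, fun g => by
      refine split_hom_ext φ (fun a => ?_) fun σ => ?_
      · change ℓ (splitAct φ g (a, 0)) = (Rep.leftRegular R G ⊗ A).ρ g (ℓ (a, 0))
        rw [splitAct_inl, hA, hA]
        exact Rep.hom_comm_apply (tensorIncl A) g a
      · change ℓ (splitAct φ g (splitX φ σ)) = (Rep.leftRegular R G ⊗ A).ρ g (ℓ (splitX φ σ))
        -- The rule for `g • x_σ` is the relation `dχ = φ` solved for `g χ(σ)`.
        rw [splitAct_splitX, map_add, map_sub, hX, hX, hX, hA, ← hd]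
        abel⟩
  refine ⟨{ τ₁ := (λ_ A).inv, τ₂ := t₂, τ₃ := κ, comm₁₂ := ?_, comm₂₃ := ?_ }, rfl, rfl⟩
  · ext : 2
    refine LinearMap.ext fun a => ?_
    exact (hA a).symm
  · ext : 2
    refine split_hom_ext φ (fun a => ?_) fun σ => ?_
    · change (tensorProj A).hom (ℓ (a, 0)) = κ.hom (splitProjLin (a, 0))
      rw [hA, tensorProj_tensorIncl]
      simp [splitProjLin]
    · change (tensorProj A).hom (ℓ (splitX φ σ)) = κ.hom (splitProjLin (splitX φ σ))
      rw [hX, splitProjLin_splitX, hκ]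

/-! ### Comparison of the cup product with the composite of connecting maps -/

/-- The cup product with a class of degree `2` obtained from an invariant element by dimension
shifting. -/
lemma cupUnit_two_shiftUp (A : Rep.{u} R G)
    (z : (tateComplex (coaugQuot R G ⊗ (coaugQuot R G ⊗ A))).cycles 0)
    (x : tateCohomology (Rep.trivial R G R) (-2)) :
    cupUnit A 2 (-2) 0 (by norm_num) ((shiftUp A 1 2 (by norm_num)).hom.hom
      ((shiftUp (coaugQuot R G ⊗ A) 0 1 (by norm_num)).hom.hom
        (((tateComplex _).homologyπ 0).hom z))) x =
      (shiftUp A (-1) 0 (by norm_num)).hom.hom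
        ((shiftUp (coaugQuot R G ⊗ A) (-2) (-1) (by norm_num)).hom.hom
          (((tateCohomologyFunctor (-2)).map
            (tmulLeft (𝟙_ (Rep.{u} R G)) (cocycleVal _ z) ≫ (ρ_ _).hom)).hom x)) := by
  have h₂ := cupNonneg_shiftUp_unit 1 A 2 1 (-2) 0 (-1) rfl (by norm_num) (by norm_num)
    (by norm_num) ((shiftUp (coaugQuot R G ⊗ A) 0 1 (by norm_num)).hom.hom
      (((tateComplex _).homologyπ 0).hom z)) x
  have h₁ := cupNonneg_shiftUp_unit 0 (coaugQuot R G ⊗ A) 1 0 (-2) (-1) (-2) rfl (by norm_num)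
    (by norm_num) (by norm_num) (((tateComplex _).homologyπ 0).hom z) x
  have h₀ := cupNonneg_zero_homologyπ _ (𝟙_ (Rep.{u} R G)) (-2) z x
  refine Eq.trans ?_ (h₂.trans (congrArg (shiftUp A (-1) 0 (by norm_num)).hom.hom
    (h₁.trans (congrArg (shiftUp (coaugQuot R G ⊗ A) (-2) (-1) (by norm_num)).hom.hom ?_))))
  -- At the numeral `2`, the case distinction in `cup` evaluates to `cupNonneg 2`.
  · rfl
  · refine (congrArg ((tateCohomologyFunctor (-2)).map (ρ_ _).hom).hom h₀).trans ?_
    exact (congrArg (fun f => f.hom x) ((tateCohomologyFunctor (-2)).map_comp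
      (tmulLeft (𝟙_ (Rep.{u} R G)) (cocycleVal _ z)) (ρ_ _).hom)).symm

/-- Naturality of connecting homomorphisms, for a map to a dimension-shifting sequence. -/
lemma δ_shiftUp {S : ShortComplex (Rep.{u} R G)} (h : (S.map (tateComplexFunctor R G)).ShortExact)
    (M : Rep.{u} R G) (F : S ⟶ (coaugSeq R G).map (tensorRight M)) (i j : ℤ) (hij : i + 1 = j)
    (f : S.X₁ ⟶ M) (hf : F.τ₁ ≫ (λ_ M).hom = f) (x : tateCohomology S.X₃ i) :
    ((tateCohomologyFunctor j).map f).hom ((h.δ i j hij).hom x) =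
      (shiftUp M i j hij).hom.hom (((tateCohomologyFunctor i).map F.τ₃).hom x) := by
  subst hf
  have hn := δ_naturality h
    (TateCohomology.map_tateComplexFunctor_shortExact (coaugSeq_tensor M)) F i j hij
  have h₁ : h.δ i j hij ≫ (tateCohomologyFunctor j).map (F.τ₁ ≫ (λ_ M).hom) =
      (tateCohomologyFunctor i).map F.τ₃ ≫ (shiftUp M i j hij).hom := by
    refine (congrArg (h.δ i j hij ≫ ·) ((tateCohomologyFunctor j).map_comp _ _)).trans ?_
    refine (Category.assoc _ _ _).symm.trans ?_
    refine (congrArg (· ≫ (tateCohomologyFunctor j).map (λ_ M).hom) hn).trans ?_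
    exact Category.assoc _ _ _
  exact congrArg (fun f => f.hom x) h₁

/-- The composite of the connecting homomorphisms is the cup product with the class of `φ`. -/
theorem reciprocityInv_eq_cupUnit {A : Rep.{u} R G} (φ : cocycles₂ A)
    (x : tateCohomology (Rep.trivial R G R) (-2)) :
    (reciprocityInv φ).hom x = cupUnit A 2 (-2) 0 (by norm_num) (tateClass φ) x := by
  obtain ⟨z₂, hz₂, hφ⟩ := exists_cycles_tateClass φ
  have hd₂ : (inhomogeneousCochains.d A 2).hom (fun g : Fin 2 → G => φ (g 0, g 1)) = 0 := by
    rw [← hφ, ← inhomogeneousCochains.d_def]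
    exact congrArg (fun f => f.hom z₂) ((tateComplex A).iCycles_d 2 3)
  obtain ⟨χ₁, hχ₁, hd₁⟩ := exists_d_eq_tensorIncl A 1 _ hd₂
  obtain ⟨χ₀, hχ₀, hd₀⟩ := exists_d_eq_tensorIncl (coaugQuot R G ⊗ A) 0 _ hd₁
  obtain ⟨z₁, hz₁⟩ := exists_cycles _ 1 _ hd₁
  obtain ⟨z₀, hz₀⟩ := exists_cycles _ 0 _ hd₀
  have hs₁ := shiftUp_homologyπ A 1 χ₁ z₁ hz₁ _ hχ₁.symm z₂ hφ
  have hs₀ := shiftUp_homologyπ (coaugQuot R G ⊗ A) 0 χ₀ z₀ hz₀ _ hχ₀.symm z₁ hz₁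
  obtain ⟨F, hF₃, hF₁⟩ := exists_augSeq_hom (coaugQuot R G ⊗ A) (χ₀ default)
    (fun g => (tensorProj A).hom (χ₁ fun _ => g)) fun g =>
      (d_zero_apply _ χ₀ fun _ => g).symm.trans (congrFun hχ₀ fun _ => g)
  -- The right end of the second ladder is taken to be the left end of the first, so that the two
  -- naturality squares compose.
  obtain ⟨F', hF'₁, hF'₃⟩ := exists_splitSeq_hom φ χ₁ hχ₁ (F.τ₁ ≫ (λ_ _).hom) fun g => by
    refine (congrArg (λ_ (coaugQuot R G ⊗ A : Rep.{u} R G)).hom.hom (hF₁ g)).trans ?_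
    exact congrArg (fun f : (coaugQuot R G ⊗ A : Rep.{u} R G) ⟶ coaugQuot R G ⊗ A =>
      f.hom ((tensorProj A).hom (χ₁ fun _ => g))) (λ_ _).inv_hom_id
  -- Both maps start from `R`, so it suffices that each sends `1` to the invariant element, the
  -- image of `χ₀`.
  have hτ : tmulLeft (𝟙_ (Rep.{u} R G)) (cocycleVal _ z₀) ≫ (ρ_ _).hom = F.τ₃ := by
    ext : 2
    refine LinearMap.ext_ring ?_
    refine Eq.trans ?_ hF₃.symm
    refine (one_smul R _).trans ?_
    exact congrFun hz₀ default
  have hcls : tateClass φ = (shiftUp A 1 2 (by norm_num)).hom.hom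
      ((shiftUp (coaugQuot R G ⊗ A) 0 1 (by norm_num)).hom.hom
        (((tateComplex _).homologyπ 0).hom z₀)) :=
    hz₂.symm.trans (hs₁.symm.trans (congrArg (shiftUp A 1 2 (by norm_num)).hom.hom hs₀.symm))
  have h₁ := δ_shiftUp (TateCohomology.map_tateComplexFunctor_shortExact
    (augSeq_shortExact (R := R) (G := G))) _ F (-2) (-1) (by simp) _ rfl x
  have h₂ := δ_shiftUp (TateCohomology.map_tateComplexFunctor_shortExact (splitSeq_shortExact φ))
    A F' (-1) 0 (by simp) (𝟙 A) (by rw [hF'₁]; exact (λ_ A).inv_hom_id)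
    (((TateCohomology.map_tateComplexFunctor_shortExact
      (augSeq_shortExact (R := R) (G := G))).δ (-2) (-1) (by simp)).hom x)
  rw [hF'₃] at h₂
  rw [hcls, cupUnit_two_shiftUp, hτ]
  refine Eq.trans ?_ (h₂.trans (congrArg (shiftUp A (-1) 0 (by norm_num)).hom.hom h₁))
  -- The left end of the second ladder contributes only the map induced by `𝟙 A`.
  exact (congrArg (fun f => f.hom ((reciprocityInv φ).hom x))
    ((tateCohomologyFunctor 0).map_id A)).symm

end TateCup

end

theorem mainTheorem9 (K L : Type) [Field K] [ValuativeRel K] [TopologicalSpace K]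
    [IsNonarchimedeanLocalField K] [Field L] [Algebra K L] [FiniteDimensional K L] [IsGalois K L]
    (φ : groupCohomology.cocycles₂ (Rep.ofAlgebraAutOnUnits K L))
    (hφ : ∀ c : groupCohomology.H2 (Rep.ofAlgebraAutOnUnits K L),
      ∃ n : ℤ, c = n • groupCohomology.H2π (Rep.ofAlgebraAutOnUnits K L) φ)
    (x : tateCohomology (Rep.trivial ℤ (L ≃ₐ[K] L) ℤ) (-2)) :
    (TateCup.reciprocityInv φ).hom x =
      TateCup.cupUnit (Rep.ofAlgebraAutOnUnits K L) 2 (-2) 0 (by norm_num)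
        (TateCup.tateClass φ) x :=
  TateCup.reciprocityInv_eq_cupUnit φ x
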